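/- Let $\Bbbk$ be a commutative ring (for instance a field). A graded coalgebra over $\Bbbk$ is a coalgebra $C=\bigoplus_{n\ge0}C_n$ with $\Delta(C_n)\subseteq\bigoplus_{i+j=n}C_i\otimes C_j$ and with counit $\epsilon$ vanishing on $C_n$ for $n>0$; it is connected if $\epsilon$ restricts to an isomorphism $C_0\to\Bbbk$. A *combinatorial coalgebra* is a pair $(C,\zeta)$ where $C$ is a graded connected coalgebra with all $C_n$ finitely generated over $\Bbbk$ and $\zeta\colon C\to\Bbbk$ is a linear functional with $\zeta|_{C_0}=\epsilon|_{C_0}$. A *combinatorial Hopf algebra* is a pair $(\mathcal H,\zeta)$ where $\mathcal H=\bigoplus_{n\ge0}\mathcal H_n$ is a graded Hopf algebra (all structure maps preserve the grading) with $\mathcal H_0=\Bbbk\cdot1$ and all $\mathcal H_n$ finitely generated over $\Bbbk$, and $\zeta\colon\mathcal H\to\Bbbk$ is a character, i.e. a morphism of algebras. A morphism $(\mathcal H',\zeta')\to(\mathcal H,\zeta)$ of combinatorial coalgebras (Hopf algebras) is a morphism $\alpha\colon\mathcal H'\to\mathcal H$ of graded coalgebras (Hopf algebras) with $\zeta\circ\alpha=\zeta'$.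 For a composition $\alpha=(a_1,\dots,a_k)$ of $n$, written $\alpha\models n$ (positive integers with $a_1+\cdots+a_k=n$; the empty composition $()$ is the only composition of $0$), let $M_\alpha=\sum_{i_1<\cdots<i_k}x_{i_1}^{a_1}\cdots x_{i_k}^{a_k}$, a formal power series in $x_1,x_2,\dots$, with $M_{()}=1$. Let $\mathrm{QSym}$ be the algebra of quasi-symmetric functions over $\Bbbk$, i.e. the subalgebra of the algebra of formal power series spanned by all the $M_\alpha$. It is a graded connected Hopf algebra, with $\mathrm{QSym}_n$ spanned by $\{M_\alpha\}_{\alpha\models n}$, coproduct $\Delta(M_\alpha)=\sum_{\alpha=\beta\gamma}M_\beta\otimes M_\gamma$ (sum over all ways to write $\alpha$ as a concatenation), and the constant coefficient as counit. Let $\zeta_{\mathcal Q}\colon\mathrm{QSym}\to\Bbbk$ be the character given by the substitution $x_1=1$ and $x_i=0$ for $i\ne1$. **Theorem.** For every combinatorial coalgebra (respectively, combinatorial Hopf algebra) $(\mathcal H,\zeta)$ there exists a unique morphism of combinatorial coalgebras (respectively, combinatorial Hopf algebras) $$\Psi\colon(\mathcal H,\zeta)\to(\mathrm{QSym},\zeta_{\mathcal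 Q}).$$ Moreover, for all $n\ge0$ and $h\in\mathcal H_n$, $$\Psi(h)=\sum_{\alpha\models n}\zeta_\alpha(h)\,M_\alpha,$$ where, for $\alpha=(a_1,\dots,a_k)$, $\zeta_\alpha$ is the composite $$\mathcal H\xrightarrow{\ \Delta^{(k-1)}\ }\mathcal H^{\otimes k}\twoheadrightarrow\mathcal H_{a_1}\otimes\cdots\otimes\mathcal H_{a_k}\xrightarrow{\ \zeta^{\otimes k}\ }\Bbbk$$ of the iterated coproduct, the canonical projection onto a homogeneous component, and $\zeta^{\otimes k}$ (for $k=0$, $\zeta_{()}=\epsilon$). Consequently, $(\mathrm{QSym},\zeta_{\mathcal Q})$ is a terminal object both in the category of combinatorial coalgebras and in the category of combinatorial Hopf algebras over $\Bbbk$. -/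

import Mathlib

universe u v w

namespace QSymCat

open scoped TensorProduct

/-- The list of nonzero exponents of a monomial `x^m`, in increasing order of the variables. -/
noncomputable def shape (m : ℕ →₀ ℕ) : List ℕ := (m.support.sort (· ≤ ·)).map m

/-- The monomial quasi-symmetric function
`M_α = ∑_{i_1 < ⋯ < i_k} x_{i_1}^{a_1} ⋯ x_{i_k}^{a_k}` for `α = (a_1, …, a_k)`, as a formal power
series in the variables `x_0, x_1, …`: the sum of all monomials whose exponents, read in increasing
order of the variables, are `a_1, …, a_k`. (It is used only for lists of positive integers; if
some entry is zero, it is `0`.) -/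
noncomputable def monoSeries (k : Type*) [CommRing k] (α : List ℕ) : MvPowerSeries ℕ k :=
  fun m => if shape m = α then 1 else 0

section lists

theorem shape_toFinsupp (l : List ℕ) : shape l.toFinsupp = l.filter (· ≠ 0) := by
  have h1 : l.toFinsupp.support.sort (· ≤ ·) =
      (List.range l.length).filter (fun i => l.getD i 0 ≠ 0) := by
    have h2 : l.toFinsupp.support =
        ((List.range l.length).filter (fun i => l.getD i 0 ≠ 0)).toFinset := by
      ext i
      simp [List.toFinsupp_support]
    rw [h2, List.toFinset_sort (· ≤ ·) (List.Nodup.filter _ List.nodup_range)]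
    exact List.Pairwise.filter _ List.pairwise_le_range
  rw [shape, h1]
  have h3 : l = (List.range l.length).map (fun i => l.getD i 0) := by
    apply List.ext_getElem
    · simp
    · intro i h _
      simp [h]
  conv_rhs => rw [h3]
  rw [List.filter_map]
  rfl

theorem exists_toFinsupp (m : ℕ →₀ ℕ) : ∃ l : List ℕ, l.toFinsupp = m := by
  refine ⟨(List.range (m.support.sup id + 1)).map m, ?_⟩
  ext i
  rw [List.toFinsupp_apply]
  by_cases h : i < m.support.sup id + 1
  · simp [h]
  · have : m i = 0 := by
      by_contra hi
      exact h (Nat.lt_succ_of_le (Finset.le_sup (f := id) (Finsupp.mem_support_iff.2 hi)))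
    rw [this, List.getD_eq_default]
    simpa using h

theorem shape_ne_zero (m : ℕ →₀ ℕ) : ∀ a ∈ shape m, a ≠ 0 := by
  obtain ⟨l, rfl⟩ := exists_toFinsupp m
  rw [shape_toFinsupp]
  simp

theorem shape_shape (m : ℕ →₀ ℕ) : shape (shape m).toFinsupp = shape m := by
  rw [shape_toFinsupp, List.filter_eq_self]
  simpa using shape_ne_zero m

theorem shape_sum (m : ℕ →₀ ℕ) : (shape m).sum = m.degree := by
  rw [shape, Finsupp.degree_apply]
  rw [← Finset.sum_map_toList]
  exact (((Finset.sort_perm_toList m.support (· ≤ ·)).map m).sum_eq)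

theorem filter_sum (l : List ℕ) : (l.filter (· ≠ 0)).sum = l.sum := by
  induction l with
  | nil => rfl
  | cons a l ih =>
    by_cases h : a = 0
    · simp_all
    · simp_all

/-- The monomial with first exponent `a` and the remaining exponents those of `m`. -/
noncomputable def consF (a : ℕ) (m : ℕ →₀ ℕ) : ℕ →₀ ℕ :=
  Finsupp.single 0 a + m.embDomain ⟨Nat.succ, Nat.succ_injective⟩

theorem consF_zero (a : ℕ) (m : ℕ →₀ ℕ) : consF a m 0 = a := by
  rw [consF, Finsupp.add_apply, Finsupp.embDomain_of_notMem_range]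
  · simp
  · simp

theorem consF_succ (a : ℕ) (m : ℕ →₀ ℕ) (i : ℕ) : consF a m (i + 1) = m i := by
  rw [consF, Finsupp.add_apply]
  have := Finsupp.embDomain_apply_self ⟨Nat.succ, Nat.succ_injective⟩ m i
  simp only [Function.Embedding.coeFn_mk, Nat.succ_eq_add_one] at this
  rw [this]
  simp

theorem toFinsupp_cons' (a : ℕ) (l : List ℕ) : (a :: l).toFinsupp = consF a l.toFinsupp := by
  ext i
  cases i with
  | zero => rw [consF_zero]; rfl
  | succ i => rw [consF_succ]; rfl

theorem exists_consF (m : ℕ →₀ ℕ) : ∃ a m', m = consF a m' := by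
  obtain ⟨l, rfl⟩ := exists_toFinsupp m
  cases l with
  | nil => refine ⟨0, 0, ?_⟩; ext i; cases i <;> simp [consF_zero, consF_succ]
  | cons a l => exact ⟨a, _, toFinsupp_cons' a l⟩

theorem consF_add (a b : ℕ) (m n : ℕ →₀ ℕ) : consF a m + consF b n = consF (a + b) (m + n) := by
  ext i; cases i <;> simp [consF_zero, consF_succ]

theorem consF_inj {a b : ℕ} {m n : ℕ →₀ ℕ} : consF a m = consF b n ↔ a = b ∧ m = n := by
  constructor
  · intro h
    refine ⟨?_, ?_⟩
    · rw [← consF_zero a m, h, consF_zero]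
    · ext i; rw [← consF_succ a m, h, consF_succ]
  · rintro ⟨rfl, rfl⟩; rfl

theorem sum_antidiagonal_consF {R : Type*} [AddCommMonoid R] (a : ℕ) (m : ℕ →₀ ℕ)
    (G : (ℕ →₀ ℕ) → (ℕ →₀ ℕ) → R) :
    ∑ p ∈ Finset.HasAntidiagonal.antidiagonal (consF a m), G p.1 p.2 =
      ∑ q ∈ Finset.HasAntidiagonal.antidiagonal a, ∑ p ∈ Finset.HasAntidiagonal.antidiagonal m,
        G (consF q.1 p.1) (consF q.2 p.2) := by
  rw [← Finset.sum_product']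
  symm
  refine Finset.sum_bij (fun x _ => (consF x.1.1 x.2.1, consF x.1.2 x.2.2)) ?_ ?_ ?_ ?_
  · rintro ⟨⟨a1, a2⟩, ⟨m1, m2⟩⟩ h
    simp only [Finset.mem_product, Finset.HasAntidiagonal.mem_antidiagonal] at h ⊢
    rw [consF_add, h.1, h.2]
  · rintro ⟨⟨a1, a2⟩, ⟨m1, m2⟩⟩ _ ⟨⟨b1, b2⟩, ⟨n1, n2⟩⟩ _ h
    simp only [Prod.mk.injEq, consF_inj] at h ⊢
    tauto
  · rintro ⟨x, y⟩ h
    obtain ⟨a1, m1, rfl⟩ := exists_consF x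
    obtain ⟨a2, m2, rfl⟩ := exists_consF y
    rw [Finset.HasAntidiagonal.mem_antidiagonal, consF_add, consF_inj] at h
    exact ⟨((a1, a2), (m1, m2)), by simpa using h, rfl⟩
  · intros; rfl

/-- The sum of `F u v` over all ways to write the list `l` as a componentwise sum `u + v`. -/
def splitSum {R : Type*} [AddCommMonoid R] : (List ℕ → List ℕ → R) → List ℕ → R
  | F, [] => F [] []
  | F, a :: l => ∑ p ∈ Finset.HasAntidiagonal.antidiagonal a, splitSum (fun u v => F (p.1 :: u) (p.2 :: v)) l

theorem sum_antidiagonal_toFinsupp {R : Type*} [AddCommMonoid R] (l : List ℕ)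
    (G : (ℕ →₀ ℕ) → (ℕ →₀ ℕ) → R) :
    ∑ p ∈ Finset.HasAntidiagonal.antidiagonal l.toFinsupp, G p.1 p.2 =
      splitSum (fun u v => G u.toFinsupp v.toFinsupp) l := by
  induction l generalizing G with
  | nil => simp [splitSum]
  | cons a l ih =>
    rw [toFinsupp_cons', sum_antidiagonal_consF, splitSum]
    refine Finset.sum_congr rfl fun q _ => ?_
    rw [ih (fun m n => G (consF q.1 m) (consF q.2 n))]
    simp only [toFinsupp_cons']

theorem splitSum_filter {R : Type*} [AddCommMonoid R] (l : List ℕ) (F : List ℕ → List ℕ → R)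
    (hF : ∀ u v, F u v = F (u.filter (· ≠ 0)) (v.filter (· ≠ 0))) :
    splitSum F l = splitSum F (l.filter (· ≠ 0)) := by
  induction l generalizing F with
  | nil => rfl
  | cons a l ih =>
    by_cases h : a = 0
    · subst h
      have h2 : splitSum (fun u v => F (0 :: u) (0 :: v)) l = splitSum F l := by
        congr 1
        funext u v
        rw [hF, hF u v]
        simp
      rw [splitSum]
      simpa [h2] using ih F hF
    · rw [List.filter_cons_of_pos (by simpa using h), splitSum, splitSum]
      refine Finset.sum_congr rfl fun q _ => ih _ fun u v => ?_
      rw [hF, hF (q.1 :: _) (q.2 :: _)]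
      simp [List.filter_cons]

theorem splitSum_append {R : Type*} [AddCommMonoid R] (l l' : List ℕ)
    (F : List ℕ → List ℕ → R) :
    splitSum F (l ++ l') =
      splitSum (fun u v => splitSum (fun u' v' => F (u ++ u') (v ++ v')) l') l := by
  induction l generalizing F with
  | nil => rfl
  | cons a l ih => simp only [List.cons_append, splitSum, ih]

theorem splitSum_add {R : Type*} [AddCommMonoid R] (l : List ℕ) (F G : List ℕ → List ℕ → R) :
    splitSum (fun u v => F u v + G u v) l = splitSum F l + splitSum G l := by
  induction l generalizing F G with
  | nil => rfl
  | cons a l ih => simp only [splitSum, ih, Finset.sum_add_distrib]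

theorem splitSum_zero {R : Type*} [AddCommMonoid R] (l : List ℕ) :
    splitSum (fun _ _ => (0 : R)) l = 0 := by
  induction l with
  | nil => rfl
  | cons a l ih => simp only [splitSum, ih, Finset.sum_const_zero]

theorem splitSum_mul_left {R : Type*} [CommRing R] (c : R) (l : List ℕ)
    (F : List ℕ → List ℕ → R) :
    splitSum (fun u v => c * F u v) l = c * splitSum F l := by
  induction l generalizing F with
  | nil => rfl
  | cons a l ih => simp only [splitSum, ih, Finset.mul_sum]

theorem splitSum_mul_right {R : Type*} [CommRing R] (c : R) (l : List ℕ)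
    (F : List ℕ → List ℕ → R) :
    splitSum (fun u v => F u v * c) l = splitSum F l * c := by
  simp only [mul_comm _ c, splitSum_mul_left]

end lists

section qsym

variable (k : Type*) [CommRing k]

theorem coeff_monoSeries (α : List ℕ) (m : ℕ →₀ ℕ) :
    MvPowerSeries.coeff m (monoSeries k α) = if shape m = α then 1 else 0 := rfl

/-- The span of the series `M_α`, over all compositions `α` of all `n ≥ 0`. -/
noncomputable def qsymSpan : Submodule k (MvPowerSeries ℕ k) :=
  Submodule.span k (Set.range fun c : Σ n, Composition n => monoSeries k c.2.blocks)

variable {k}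

theorem mem_qsymSpan_iff (f : MvPowerSeries ℕ k) : f ∈ qsymSpan k ↔
    (∃ d : ℕ, ∀ m : ℕ →₀ ℕ, d < m.degree → MvPowerSeries.coeff m f = 0) ∧
    ∀ m, MvPowerSeries.coeff m f = MvPowerSeries.coeff (shape m).toFinsupp f := by
  constructor
  · intro h
    induction h using Submodule.span_induction with
    | mem x hx =>
      obtain ⟨⟨n, c⟩, rfl⟩ := hx
      refine ⟨⟨n, fun m hm => ?_⟩, fun m => ?_⟩
      · rw [coeff_monoSeries, if_neg]
        intro h
        rw [← shape_sum, h] at hm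
        simp at hm
      · simp only [coeff_monoSeries, shape_shape]
    | zero => exact ⟨⟨0, fun m _ => by simp⟩, fun m => by simp⟩
    | add x y _ _ hx hy =>
      obtain ⟨⟨d, hd⟩, hx⟩ := hx
      obtain ⟨⟨e, he⟩, hy⟩ := hy
      refine ⟨⟨max d e, fun m hm => ?_⟩, fun m => ?_⟩
      · rw [map_add, hd m (lt_of_le_of_lt (le_max_left _ _) hm),
          he m (lt_of_le_of_lt (le_max_right _ _) hm), add_zero]
      · rw [map_add, map_add, hx, hy]
    | smul r x _ hx =>
      obtain ⟨⟨d, hd⟩, hx⟩ := hx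
      refine ⟨⟨d, fun m hm => ?_⟩, fun m => ?_⟩
      · rw [map_smul, hd m hm, smul_zero]
      · rw [map_smul, map_smul, hx]
  · rintro ⟨⟨d, hd⟩, h⟩
    have key : f = ∑ n ∈ Finset.range (d + 1), ∑ c : Composition n,
        MvPowerSeries.coeff c.blocks.toFinsupp f • monoSeries k c.blocks := by
      ext m
      simp only [map_sum, map_smul, coeff_monoSeries]
      let c0 : Composition m.degree :=
        ⟨shape m, fun hi => Nat.pos_of_ne_zero (shape_ne_zero m _ hi), shape_sum m⟩
      by_cases hm : d < m.degree
      · rw [hd m hm]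
        symm
        refine Finset.sum_eq_zero fun n hn => Finset.sum_eq_zero fun c _ => ?_
        rw [if_neg, smul_zero]
        intro h'
        have := shape_sum m
        rw [h', c.blocks_sum] at this
        rw [Finset.mem_range] at hn
        omega
      · rw [Finset.sum_eq_single m.degree, Finset.sum_eq_single c0]
        · rw [if_pos rfl, smul_eq_mul, mul_one, h m]
        · intro c _ hc
          rw [if_neg, smul_zero]
          intro h'
          exact hc (Composition.ext h'.symm)
        · simp
        · intro n _ hn
          refine Finset.sum_eq_zero fun c _ => ?_
          rw [if_neg, smul_zero]
          intro h'
          have := shape_sum m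
          rw [h', c.blocks_sum] at this
          exact hn this
        · intro h'
          rw [Finset.mem_range] at h'
          omega
    rw [key]
    exact Submodule.sum_mem _ fun n _ => Submodule.sum_mem _ fun c _ =>
      Submodule.smul_mem _ _ (Submodule.subset_span ⟨⟨n, c⟩, rfl⟩)

theorem coeff_filter {f : MvPowerSeries ℕ k} (hf : f ∈ qsymSpan k) (l : List ℕ) :
    MvPowerSeries.coeff l.toFinsupp f =
      MvPowerSeries.coeff (l.filter (· ≠ 0)).toFinsupp f := by
  rw [((mem_qsymSpan_iff f).1 hf).2, shape_toFinsupp]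

theorem coeff_mul_toFinsupp (f g : MvPowerSeries ℕ k) (l : List ℕ) :
    MvPowerSeries.coeff l.toFinsupp (f * g) = splitSum (fun u v =>
      MvPowerSeries.coeff u.toFinsupp f * MvPowerSeries.coeff v.toFinsupp g) l := by
  rw [MvPowerSeries.coeff_mul]
  exact sum_antidiagonal_toFinsupp l
    (fun m n => MvPowerSeries.coeff m f * MvPowerSeries.coeff n g)

theorem monoSeries_nil : monoSeries k [] = 1 := by
  ext m
  rw [coeff_monoSeries, MvPowerSeries.coeff_one]
  congr 1
  simp only [shape, List.map_eq_nil_iff, eq_iff_iff]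
  constructor
  · intro h
    rw [← Finsupp.support_eq_empty, ← Finset.sort_toFinset m.support (· ≤ ·), h]; rfl
  · rintro rfl; simp

theorem monoSeries_mem (α : List ℕ) : monoSeries k α ∈ qsymSpan k := by
  by_cases h : ∀ a ∈ α, a ≠ 0
  · exact Submodule.subset_span ⟨⟨α.sum, ⟨α, fun hi => Nat.pos_of_ne_zero (h _ hi), rfl⟩⟩, rfl⟩
  · have : monoSeries k α = 0 := by
      ext m
      rw [coeff_monoSeries, if_neg]
      · simp
      · rintro rfl
        exact h (shape_ne_zero m)
    rw [this]
    exact Submodule.zero_mem _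

theorem mul_mem_qsymSpan {f g : MvPowerSeries ℕ k} (hf : f ∈ qsymSpan k) (hg : g ∈ qsymSpan k) :
    f * g ∈ qsymSpan k := by
  rw [mem_qsymSpan_iff]
  constructor
  · obtain ⟨d, hd⟩ := ((mem_qsymSpan_iff f).1 hf).1
    obtain ⟨e, he⟩ := ((mem_qsymSpan_iff g).1 hg).1
    refine ⟨d + e, fun m hm => ?_⟩
    rw [MvPowerSeries.coeff_mul]
    refine Finset.sum_eq_zero fun p hp => ?_
    rw [Finset.HasAntidiagonal.mem_antidiagonal] at hp
    rw [← hp, map_add] at hm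
    by_cases h : d < p.1.degree
    · rw [hd _ h, zero_mul]
    · rw [he _ (by omega), mul_zero]
  · intro m
    obtain ⟨l, rfl⟩ := exists_toFinsupp m
    rw [shape_toFinsupp, coeff_mul_toFinsupp, coeff_mul_toFinsupp]
    refine splitSum_filter _ _ fun u v => ?_
    rw [coeff_filter hf, coeff_filter hg]

variable (k)

/-- The algebra `QSym` of quasi-symmetric functions: the subalgebra of the algebra of formal power
series in `x_0, x_1, …` spanned by the monomial quasi-symmetric functions. -/
noncomputable def QSym : Subalgebra k (MvPowerSeries ℕ k) :=
  (qsymSpan k).toSubalgebra (monoSeries_nil (k := k) ▸ monoSeries_mem [])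
    (fun _ _ => mul_mem_qsymSpan)

theorem mem_QSym {f : MvPowerSeries ℕ k} : f ∈ QSym k ↔ f ∈ qsymSpan k := Iff.rfl

/-- The monomial quasi-symmetric function `M_α`, as an element of `QSym`. -/
noncomputable def M (α : List ℕ) : QSym k := ⟨monoSeries k α, monoSeries_mem α⟩

theorem M_nil : M k [] = 1 := Subtype.ext monoSeries_nil

/-- The coefficient of the monomial `x_0^{a_0} x_1^{a_1} ⋯` for the list `l = (a_0, a_1, …)`. -/
noncomputable def coeffL (l : List ℕ) : QSym k →ₗ[k] k :=
  MvPowerSeries.coeff l.toFinsupp ∘ₗ (QSym k).val.toLinearMap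

variable {k}

theorem coeffL_M (l α : List ℕ) :
    coeffL k l (M k α) = if l.filter (· ≠ 0) = α then 1 else 0 := by
  rw [← shape_toFinsupp]; rfl

theorem coeffL_filter (l : List ℕ) : coeffL k l = coeffL k (l.filter (· ≠ 0)) :=
  LinearMap.ext fun f => coeff_filter f.2 l

theorem coeffL_mul (l : List ℕ) (f g : QSym k) :
    coeffL k l (f * g) = splitSum (fun u v => coeffL k u f * coeffL k v g) l :=
  coeff_mul_toFinsupp _ _ l

theorem blocks_filter {n : ℕ} (c : Composition n) : c.blocks.filter (· ≠ 0) = c.blocks := by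
  rw [List.filter_eq_self]
  intro a ha
  simpa using (c.blocks_pos ha).ne'

theorem sigma_comp_ext {c d : Σ n, Composition n} (h : c.2.blocks = d.2.blocks) : c = d := by
  obtain ⟨n, c⟩ := c
  obtain ⟨m, d⟩ := d
  have hn : n = m := by rw [← c.blocks_sum, ← d.blocks_sum]; exact congrArg List.sum h
  subst hn
  congr 1
  exact Composition.ext h

theorem coeffL_blocks (c d : Σ n, Composition n) :
    coeffL k c.2.blocks (M k d.2.blocks) = if c = d then 1 else 0 := by
  rw [coeffL_M, blocks_filter]
  congr 1
  exact propext ⟨sigma_comp_ext, fun h => h ▸ rfl⟩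

theorem M_eq_zero {α : List ℕ} (h : 0 ∈ α) : M k α = 0 := by
  refine Subtype.ext ?_
  ext m
  change (if shape m = α then (1 : k) else 0) = 0
  rw [if_neg]
  rintro rfl
  exact shape_ne_zero m 0 h rfl

variable (k)

/-- The basis of `QSym` formed by the `M_α`, for all compositions `α`. -/
noncomputable def basisM : Module.Basis (Σ n, Composition n) k (QSym k) :=
  Module.Basis.mk (v := fun c => M k c.2.blocks)
    (by
      rw [linearIndependent_iff']
      intro s g hg i hi
      have := congrArg (coeffL k i.2.blocks) hg
      simpa [coeffL_blocks, hi] using this)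
    (by
      rintro ⟨f, hf⟩ _
      refine Submodule.span_induction (p := fun f hf => (⟨f, hf⟩ : QSym k) ∈
        Submodule.span k (Set.range fun c : Σ n, Composition n => M k c.2.blocks))
        ?_ ?_ ?_ ?_ hf
      · rintro _ ⟨c, rfl⟩
        exact Submodule.subset_span ⟨c, rfl⟩
      · exact Submodule.zero_mem _
      · intro x y _ _ hx hy
        exact Submodule.add_mem _ hx hy
      · intro a x _ hx
        exact Submodule.smul_mem _ a hx)

variable {k}

theorem basisM_apply (c : Σ n, Composition n) : basisM k c = M k c.2.blocks := by
  simp [basisM]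

theorem basisM_coord (c : Σ n, Composition n) : (basisM k).coord c = coeffL k c.2.blocks := by
  refine (basisM k).ext fun d => ?_
  rw [basisM_apply, coeffL_blocks, ← basisM_apply, Module.Basis.coord_apply,
    Module.Basis.repr_self, Finsupp.single_apply]
  simp only [eq_comm]

/-- A composition, from its list of parts. -/
def compOf (α : List ℕ) (h : 0 ∉ α) : Σ n, Composition n :=
  ⟨α.sum, ⟨α, fun hi => Nat.pos_of_ne_zero fun h0 => h (h0 ▸ hi), rfl⟩⟩

theorem M_eq_basisM (α : List ℕ) (h : 0 ∉ α) : M k α = basisM k (compOf α h) := by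
  rw [basisM_apply]; rfl

theorem lin_ext {N : Type*} [AddCommMonoid N] [Module k N] {f g : QSym k →ₗ[k] N}
    (h : ∀ α : List ℕ, 0 ∉ α → f (M k α) = g (M k α)) : f = g :=
  (basisM k).ext fun c => by
    rw [basisM_apply]
    exact h _ fun h0 => absurd (c.2.blocks_pos h0) (lt_irrefl 0)

end qsym

section coalgebra

variable (k : Type*) [CommRing k]

/-- The coproduct of `QSym`: `Δ(M_α) = ∑_{α = βγ} M_β ⊗ M_γ`, the sum over all ways to cut `α`
into an initial part `β` and a final part `γ`. -/
noncomputable def comulL : QSym k →ₗ[k] QSym k ⊗[k] QSym k :=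
  (basisM k).constr k fun c => ∑ i ∈ Finset.range (c.2.blocks.length + 1),
    M k (c.2.blocks.take i) ⊗ₜ[k] M k (c.2.blocks.drop i)

/-- The product of the functionals taking the coefficients at `u` and `v`. -/
noncomputable def pr (u v : List ℕ) : QSym k ⊗[k] QSym k →ₗ[k] k :=
  LinearMap.mul' k k ∘ₗ TensorProduct.map (coeffL k u) (coeffL k v)

variable {k}

theorem pr_tmul (u v : List ℕ) (f g : QSym k) :
    pr k u v (f ⊗ₜ g) = coeffL k u f * coeffL k v g := rfl

theorem pr_filter (u v : List ℕ) :
    pr k u v = pr k (u.filter (· ≠ 0)) (v.filter (· ≠ 0)) := by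
  rw [pr, coeffL_filter u, coeffL_filter v]; rfl

theorem comulL_M (α : List ℕ) (h : 0 ∉ α) : comulL k (M k α) =
    ∑ i ∈ Finset.range (α.length + 1), M k (α.take i) ⊗ₜ[k] M k (α.drop i) := by
  rw [M_eq_basisM α h, comulL, Module.Basis.constr_basis]
  rfl

theorem pr_comulL (u v : List ℕ) (f : QSym k) : pr k u v (comulL k f) = coeffL k (u ++ v) f := by
  suffices h : pr k u v ∘ₗ comulL k = coeffL k (u ++ v) from LinearMap.congr_fun h f
  refine lin_ext fun α hα => ?_
  rw [LinearMap.comp_apply, comulL_M α hα, map_sum]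
  simp only [pr_tmul, coeffL_M, List.filter_append]
  generalize u.filter (· ≠ 0) = u'
  generalize v.filter (· ≠ 0) = v'
  by_cases h : u' ++ v' = α
  · subst h
    rw [Finset.sum_eq_single u'.length]
    · simp
    · intro i hi hne
      rw [if_neg, zero_mul]
      intro h'
      have := congrArg List.length h'
      simp at this hi
      omega
    · simp
  · rw [if_neg h]
    refine Finset.sum_eq_zero fun i _ => ?_
    by_cases h1 : u' = α.take i
    · by_cases h2 : v' = α.drop i
      · exact absurd (by rw [h1, h2, List.take_append_drop]) h
      · rw [if_neg h2, mul_zero]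
    · rw [if_neg h1, zero_mul]

theorem tensor_ext {N P ι κ : Type*} [AddCommMonoid N] [Module k N] [AddCommMonoid P] [Module k P]
    (b : Module.Basis ι k N) (c : Module.Basis κ k P) {x y : N ⊗[k] P}
    (h : ∀ i j, (LinearMap.mul' k k ∘ₗ TensorProduct.map (b.coord i) (c.coord j)) x =
      (LinearMap.mul' k k ∘ₗ TensorProduct.map (b.coord i) (c.coord j)) y) : x = y := by
  refine (b.tensorProduct c).ext_elem fun ⟨i, j⟩ => ?_
  have key : (b.tensorProduct c).coord (i, j) =
      LinearMap.mul' k k ∘ₗ TensorProduct.map (b.coord i) (c.coord j) := by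
    refine TensorProduct.ext' fun f g => ?_
    rw [Module.Basis.coord_apply, Module.Basis.tensorProduct_repr_tmul_apply, smul_eq_mul, mul_comm]
    rfl
  rw [← Module.Basis.coord_apply, ← Module.Basis.coord_apply, key, h]

theorem pr_ext {x y : QSym k ⊗[k] QSym k} (h : ∀ u v, pr k u v x = pr k u v y) : x = y := by
  refine tensor_ext (basisM k) (basisM k) fun c d => ?_
  rw [basisM_coord, basisM_coord]
  exact h _ _

theorem pr3_ext {x y : QSym k ⊗[k] (QSym k ⊗[k] QSym k)}
    (h : ∀ u v w, (LinearMap.mul' k k ∘ₗ TensorProduct.map (coeffL k u) (pr k v w)) x =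
      (LinearMap.mul' k k ∘ₗ TensorProduct.map (coeffL k u) (pr k v w)) y) : x = y := by
  refine tensor_ext (basisM k) ((basisM k).tensorProduct (basisM k)) fun c ⟨d, e⟩ => ?_
  have key : ((basisM k).tensorProduct (basisM k)).coord (d, e) =
      pr k d.2.blocks e.2.blocks := by
    refine TensorProduct.ext' fun f g => ?_
    rw [Module.Basis.coord_apply, Module.Basis.tensorProduct_repr_tmul_apply, pr_tmul,
      ← basisM_coord, ← basisM_coord, smul_eq_mul, mul_comm]
    rfl
  rw [basisM_coord, key]
  exact h _ _ _

variable (k)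

/-- The coalgebra structure of `QSym`; the counit is the constant coefficient. -/
noncomputable instance instCoalgebra : Coalgebra k (QSym k) where
  comul := comulL k
  counit := (MvPowerSeries.coeff 0 : MvPowerSeries ℕ k →ₗ[k] k) ∘ₗ (QSym k).val.toLinearMap
  coassoc := by
    refine LinearMap.ext fun f => pr3_ext fun u v w => ?_
    have h1 : (LinearMap.mul' k k ∘ₗ TensorProduct.map (coeffL k u) (pr k v w)) ∘ₗ
        (TensorProduct.assoc k (QSym k) (QSym k) (QSym k)).toLinearMap =
        LinearMap.mul' k k ∘ₗ TensorProduct.map (pr k u v) (coeffL k w) := by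
      refine TensorProduct.ext_threefold fun x y z => ?_
      simp [pr_tmul, mul_assoc]
    have h2 : pr k u v ∘ₗ comulL k = coeffL k (u ++ v) := LinearMap.ext (pr_comulL u v)
    have h3 : pr k v w ∘ₗ comulL k = coeffL k (v ++ w) := LinearMap.ext (pr_comulL v w)
    have h4 : LinearMap.mul' k k ∘ₗ TensorProduct.map (pr k u v) (coeffL k w) ∘ₗ
        (comulL k).rTensor (QSym k) = pr k (u ++ v) w := by
      rw [LinearMap.rTensor, ← TensorProduct.map_comp, h2]; rfl
    have h5 : LinearMap.mul' k k ∘ₗ TensorProduct.map (coeffL k u) (pr k v w) ∘ₗ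
        (comulL k).lTensor (QSym k) = pr k u (v ++ w) := by
      rw [LinearMap.lTensor, ← TensorProduct.map_comp, h3]; rfl
    calc _ = ((LinearMap.mul' k k ∘ₗ TensorProduct.map (coeffL k u) (pr k v w)) ∘ₗ
        (TensorProduct.assoc k (QSym k) (QSym k) (QSym k)).toLinearMap)
          ((comulL k).rTensor (QSym k) (comulL k f)) := rfl
      _ = (LinearMap.mul' k k ∘ₗ TensorProduct.map (pr k u v) (coeffL k w) ∘ₗ
        (comulL k).rTensor (QSym k)) (comulL k f) := by rw [h1]; rfl
      _ = (LinearMap.mul' k k ∘ₗ TensorProduct.map (coeffL k u) (pr k v w) ∘ₗ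
        (comulL k).lTensor (QSym k)) (comulL k f) := by
          rw [h4, h5, pr_comulL, pr_comulL, List.append_assoc]
      _ = _ := rfl
  rTensor_counit_comp_comul := by
    refine lin_ext fun α hα => ?_
    rw [LinearMap.comp_apply, comulL_M α hα, map_sum, Finset.sum_range_succ', Finset.sum_eq_zero]
    · have : coeffL k [] (M k []) = 1 := by simp [coeffL_M]
      change 0 + coeffL k [] (M k []) ⊗ₜ[k] M k α = (1 : k) ⊗ₜ[k] M k α
      rw [this, zero_add]
    · intro i hi
      have : coeffL k [] (M k (α.take (i + 1))) = 0 := by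
        rw [coeffL_M, if_neg]
        intro h
        have := congrArg List.length h
        simp only [List.filter_nil, List.length_nil, List.length_take, Finset.mem_range] at this hi
        omega
      change coeffL k [] (M k (α.take (i + 1))) ⊗ₜ[k] M k (α.drop (i + 1)) = 0
      rw [this, TensorProduct.zero_tmul]
  lTensor_counit_comp_comul := by
    refine lin_ext fun α hα => ?_
    rw [LinearMap.comp_apply, comulL_M α hα, map_sum, Finset.sum_range_succ, Finset.sum_eq_zero]
    · have : coeffL k [] (M k (α.drop α.length)) = 1 := by
        simp [coeffL_M]
      change 0 + M k (α.take α.length) ⊗ₜ[k] coeffL k [] (M k (α.drop α.length)) =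
        M k α ⊗ₜ[k] (1 : k)
      rw [this, zero_add, List.take_length]
    · intro i hi
      have : coeffL k [] (M k (α.drop i)) = 0 := by
        rw [coeffL_M, if_neg]
        intro h
        have := congrArg List.length h
        simp at this hi
        omega
      change M k (α.take i) ⊗ₜ[k] coeffL k [] (M k (α.drop i)) = 0
      rw [this, TensorProduct.tmul_zero]

variable {k}

theorem counit_eq (f : QSym k) : Coalgebra.counit (R := k) f = coeffL k [] f := rfl

theorem comul_eq : (Coalgebra.comul : QSym k →ₗ[k] _) = comulL k := rfl

theorem pr_mul (u v : List ℕ) (x y : QSym k ⊗[k] QSym k) :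
    pr k u v (x * y) = splitSum (fun a b => splitSum (fun a' b' =>
      pr k a a' x * pr k b b' y) v) u := by
  induction x with
  | zero => simp [splitSum_zero]
  | add x x' hx hx' =>
    simp only [add_mul, map_add, splitSum_add, hx, hx']
  | tmul f g =>
    induction y with
    | zero => simp [splitSum_zero]
    | add y y' hy hy' => simp only [mul_add, map_add, splitSum_add, hy, hy']
    | tmul f' g' =>
      rw [Algebra.TensorProduct.tmul_mul_tmul, pr_tmul, coeffL_mul, coeffL_mul,
        ← splitSum_mul_right]
      congr 1
      funext a b
      rw [← splitSum_mul_left]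
      congr 1
      funext a' b'
      rw [pr_tmul, pr_tmul]
      ring

theorem comulL_mul (f g : QSym k) : comulL k (f * g) = comulL k f * comulL k g := by
  refine pr_ext fun u v => ?_
  rw [pr_comulL, coeffL_mul, splitSum_append, pr_mul]
  simp only [pr_comulL]

variable (k)

/-- `QSym` is a bialgebra. -/
noncomputable instance instBialgebra : Bialgebra k (QSym k) :=
  Bialgebra.mk' k (QSym k)
    (by
      change MvPowerSeries.coeff 0 (1 : MvPowerSeries ℕ k) = 1
      simp)
    (by
      intro f g
      rw [counit_eq, counit_eq, counit_eq, coeffL_mul]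
      rfl)
    (by
      rw [comul_eq, ← M_nil, comulL_M _ (by simp)]
      simp [M_nil, Algebra.TensorProduct.one_def])
    (fun {f g} => comulL_mul f g)

/-- The values on `M_α` of a left convolution inverse of the identity of `QSym`. -/
noncomputable def antipodeVal (α : List ℕ) : QSym k :=
  if α = [] then 1 else
    -∑ i : Fin α.length, antipodeVal (α.take i) * M k (α.drop i)
termination_by α.length
decreasing_by
  have := i.2
  rw [List.length_take]
  omega

/-- The values on `M_α` of a right convolution inverse of the identity of `QSym`. -/
noncomputable def antipodeVal' (α : List ℕ) : QSym k :=
  if α = [] then 1 else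
    -∑ i : Fin α.length, M k (α.take (i + 1)) * antipodeVal' (α.drop (i + 1))
termination_by α.length
decreasing_by
  have := i.2
  rw [List.length_drop]
  omega

/-- The antipode of `QSym`, determined by the recursion
`S(M_α) = -∑_{α = βγ, γ ≠ ()} S(M_β) M_γ` for `α ≠ ()`, and `S(1) = 1`. -/
noncomputable def antipodeL : QSym k →ₗ[k] QSym k :=
  (basisM k).constr k fun c => antipodeVal k c.2.blocks

/-- The right convolution inverse of the identity of `QSym`. -/
noncomputable def antipodeL' : QSym k →ₗ[k] QSym k :=
  (basisM k).constr k fun c => antipodeVal' k c.2.blocks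

variable {k}

theorem antipodeL_M (α : List ℕ) (h : 0 ∉ α) : antipodeL k (M k α) = antipodeVal k α := by
  rw [M_eq_basisM α h, antipodeL, Module.Basis.constr_basis]; rfl

theorem antipodeL'_M (α : List ℕ) (h : 0 ∉ α) : antipodeL' k (M k α) = antipodeVal' k α := by
  rw [M_eq_basisM α h, antipodeL', Module.Basis.constr_basis]; rfl

theorem counit_M (α : List ℕ) (h : 0 ∉ α) :
    algebraMap k (QSym k) (Coalgebra.counit (R := k) (M k α)) = if α = [] then 1 else 0 := by
  rw [counit_eq, coeffL_M]
  by_cases hα : α = []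
  · subst hα; simp
  · rw [if_neg hα, if_neg, map_zero]
    exact fun h => hα h.symm

theorem antipodeL_left : LinearMap.mul' k (QSym k) ∘ₗ (antipodeL k).rTensor (QSym k) ∘ₗ
    Coalgebra.comul = Algebra.linearMap k (QSym k) ∘ₗ Coalgebra.counit := by
  refine lin_ext fun α hα => ?_
  rw [LinearMap.comp_apply (Algebra.linearMap k (QSym k)), Algebra.linearMap_apply, counit_M α hα]
  rw [LinearMap.comp_apply, LinearMap.comp_apply, comul_eq, comulL_M α hα, map_sum, map_sum]
  have h1 : ∀ i, LinearMap.mul' k (QSym k) ((antipodeL k).rTensor (QSym k)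
      (M k (α.take i) ⊗ₜ[k] M k (α.drop i))) = antipodeVal k (α.take i) * M k (α.drop i) := by
    intro i
    rw [LinearMap.rTensor_tmul, LinearMap.mul'_apply, antipodeL_M]
    exact fun h => hα (List.mem_of_mem_take h)
  simp only [h1]
  rw [Finset.sum_range_succ, List.take_length, List.drop_length, M_nil, mul_one,
    Finset.sum_range (fun i => antipodeVal k (α.take i) * M k (α.drop i))]
  rw [antipodeVal.eq_1 k α]
  split_ifs with h
  · subst h; simp
  · simp

theorem antipodeL'_right : LinearMap.mul' k (QSym k) ∘ₗ (antipodeL' k).lTensor (QSym k) ∘ₗ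
    Coalgebra.comul = Algebra.linearMap k (QSym k) ∘ₗ Coalgebra.counit := by
  refine lin_ext fun α hα => ?_
  rw [LinearMap.comp_apply (Algebra.linearMap k (QSym k)), Algebra.linearMap_apply, counit_M α hα]
  rw [LinearMap.comp_apply, LinearMap.comp_apply, comul_eq, comulL_M α hα, map_sum, map_sum]
  have h1 : ∀ i, LinearMap.mul' k (QSym k) ((antipodeL' k).lTensor (QSym k)
      (M k (α.take i) ⊗ₜ[k] M k (α.drop i))) = M k (α.take i) * antipodeVal' k (α.drop i) := by
    intro i
    rw [LinearMap.lTensor_tmul, LinearMap.mul'_apply, antipodeL'_M]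
    exact fun h => hα (List.mem_of_mem_drop h)
  simp only [h1]
  rw [Finset.sum_range_succ', List.take_zero, List.drop_zero, M_nil, one_mul,
    Finset.sum_range (fun i => M k (α.take (i + 1)) * antipodeVal' k (α.drop (i + 1)))]
  rw [antipodeVal'.eq_1 k α]
  split_ifs with h
  · subst h; simp
  · simp

theorem antipodeL_eq : antipodeL k = antipodeL' k := by
  have h1 : WithConv.toConv (antipodeL k) * WithConv.toConv LinearMap.id = 1 := by
    rw [LinearMap.convMul_def, LinearMap.convOne_def]
    exact congrArg _ antipodeL_left
  have h2 : WithConv.toConv LinearMap.id * WithConv.toConv (antipodeL' k) = 1 := by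
    rw [LinearMap.convMul_def, LinearMap.convOne_def]
    exact congrArg _ antipodeL'_right
  exact WithConv.toConv_injective (left_inv_eq_right_inv h1 h2)

variable (k)

/-- `QSym` is a Hopf algebra. -/
noncomputable instance instHopfAlgebra : HopfAlgebra k (QSym k) where
  antipode := antipodeL k
  mul_antipode_rTensor_comul := antipodeL_left
  mul_antipode_lTensor_comul := by rw [antipodeL_eq]; exact antipodeL'_right

end coalgebra

section grading

variable (k : Type*) [CommRing k]

/-- The homogeneous component of degree `n` of `QSym`: the span of the `M_α` with `α ⊨ n`. -/
noncomputable def grading (n : ℕ) : Submodule k (QSym k) :=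
  Submodule.span k (Set.range fun c : Composition n => M k c.blocks)

variable {k}

theorem M_mem_grading (α : List ℕ) : M k α ∈ grading k α.sum := by
  by_cases h : 0 ∈ α
  · rw [M_eq_zero h]; exact Submodule.zero_mem _
  · exact Submodule.subset_span ⟨(compOf α h).2, rfl⟩

theorem coeffL_of_mem_grading {n : ℕ} {f : QSym k} (hf : f ∈ grading k n) (l : List ℕ)
    (hl : l.sum ≠ n) : coeffL k l f = 0 := by
  induction hf using Submodule.span_induction with
  | mem x hx =>
    obtain ⟨c, rfl⟩ := hx
    rw [coeffL_M, if_neg]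
    intro h
    apply hl
    rw [← filter_sum, h, c.blocks_sum]
  | zero => simp
  | add x y _ _ hx hy => rw [map_add, hx, hy, add_zero]
  | smul r x _ hx => rw [map_smul, hx, smul_zero]

theorem mem_grading_of_coeffL {n : ℕ} {f : QSym k}
    (h : ∀ l : List ℕ, l.sum ≠ n → coeffL k l f = 0) : f ∈ grading k n := by
  rw [← (basisM k).linearCombination_repr f, Finsupp.linearCombination_apply]
  refine Submodule.sum_mem _ fun c _ => ?_
  by_cases hc : c.2.blocks.sum = n
  · subst hc
    refine Submodule.smul_mem _ _ ?_
    rw [basisM_apply]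
    exact M_mem_grading _
  · have : (basisM k).repr f c = 0 := by
      rw [← Module.Basis.coord_apply, basisM_coord]
      exact h _ hc
    simp only [this, zero_smul]
    exact Submodule.zero_mem _

theorem splitSum_eq_zero {R : Type*} [AddCommMonoid R] (l : List ℕ) (F : List ℕ → List ℕ → R)
    (h : ∀ u v, u.sum + v.sum = l.sum → F u v = 0) : splitSum F l = 0 := by
  induction l generalizing F with
  | nil => exact h [] [] rfl
  | cons a l ih =>
    rw [splitSum]
    refine Finset.sum_eq_zero fun p hp => ih _ fun u v huv => h _ _ ?_
    rw [Finset.HasAntidiagonal.mem_antidiagonal] at hp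
    simp only [List.sum_cons]
    omega

theorem mul_mem_grading {m n : ℕ} {f g : QSym k} (hf : f ∈ grading k m) (hg : g ∈ grading k n) :
    f * g ∈ grading k (m + n) := by
  refine mem_grading_of_coeffL fun l hl => ?_
  rw [coeffL_mul]
  refine splitSum_eq_zero _ _ fun u v huv => ?_
  by_cases hu : u.sum = m
  · rw [coeffL_of_mem_grading hg v (by omega), mul_zero]
  · rw [coeffL_of_mem_grading hf u hu, zero_mul]

theorem one_mem_grading : (1 : QSym k) ∈ grading k 0 := by
  rw [← M_nil]; exact M_mem_grading []

variable (k)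

/-- The decomposition of an element of `QSym` into homogeneous components. -/
noncomputable def decomposeL : QSym k →ₗ[k] DirectSum ℕ fun n => grading k n :=
  (basisM k).constr k fun c => DirectSum.lof k ℕ (fun n => grading k n) c.1
    ⟨M k c.2.blocks, Submodule.subset_span ⟨c.2, rfl⟩⟩

/-- `QSym` is a graded algebra. -/
noncomputable instance instGradedAlgebra : GradedAlgebra (grading k) where
  one_mem := one_mem_grading
  mul_mem := fun _ _ _ _ hf hg => mul_mem_grading hf hg
  toDecomposition := DirectSum.Decomposition.ofLinearMap (grading k) (decomposeL k)
    (by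
      refine (basisM k).ext fun c => ?_
      rw [LinearMap.comp_apply, decomposeL, Module.Basis.constr_basis,
        DirectSum.coeLinearMap_lof, basisM_apply]
      rfl)
    (by
      refine DirectSum.linearMap_ext k fun n => ?_
      refine LinearMap.ext fun x => ?_
      obtain ⟨x, hx⟩ := x
      simp only [LinearMap.comp_apply, DirectSum.coeLinearMap_lof, LinearMap.id_apply]
      induction hx using Submodule.span_induction with
      | mem y hy =>
        obtain ⟨c, rfl⟩ := hy
        have : M k c.blocks = basisM k ⟨n, c⟩ := by rw [basisM_apply]
        rw [decomposeL]
        simp only [this]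
        rw [Module.Basis.constr_basis]
        simp only [basisM_apply]
      | zero =>
        rw [map_zero]
        exact (map_zero (DirectSum.lof k ℕ (fun n => grading k n) n)).symm
      | add y z hy hz ihy ihz =>
        rw [map_add, ihy, ihz, ← map_add]; rfl
      | smul r y hy ihy =>
        rw [map_smul, ihy, ← map_smul]; rfl)

end grading

section zeta

variable {k : Type*} [CommRing k]

theorem toFinsupp_single (n : ℕ) : [n].toFinsupp = Finsupp.single 0 n := by
  ext i
  cases i <;> simp

theorem exists_poly (f : QSym k) : ∃ p : Polynomial k, ∀ n,
    p.coeff n = MvPowerSeries.coeff (Finsupp.single 0 n) (f : MvPowerSeries ℕ k) := by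
  obtain ⟨d, hd⟩ := ((mem_qsymSpan_iff _).1 f.2).1
  refine ⟨∑ n ∈ Finset.range (d + 1), Polynomial.monomial n
    (MvPowerSeries.coeff (Finsupp.single 0 n) (f : MvPowerSeries ℕ k)), fun n => ?_⟩
  rw [Polynomial.finsetSum_coeff]
  simp only [Polynomial.coeff_monomial]
  rw [Finset.sum_ite_eq']
  split_ifs with h
  · rfl
  · rw [hd]
    simp at h ⊢
    omega

theorem finsum_poly {f : QSym k} {p : Polynomial k} (hp : ∀ n,
    p.coeff n = MvPowerSeries.coeff (Finsupp.single 0 n) (f : MvPowerSeries ℕ k)) :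
    ∑ᶠ n : ℕ, MvPowerSeries.coeff (Finsupp.single 0 n) (f : MvPowerSeries ℕ k) = p.eval 1 := by
  simp only [← hp]
  rw [finsum_eq_sum_of_support_subset (s := p.support)]
  · rw [Polynomial.eval_eq_sum, Polynomial.sum]
    simp
  · intro n hn
    simpa using hn

variable (k)

/-- The canonical character of `QSym`: substitute `1` for the first variable `x_0` and `0` for all
the other variables. (The sum below is finite, since an element of `QSym` has bounded degree.) -/
noncomputable def zetaQ : QSym k →ₐ[k] k where
  toFun f := ∑ᶠ n : ℕ, MvPowerSeries.coeff (Finsupp.single 0 n) (f : MvPowerSeries ℕ k)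
  map_one' := by
    rw [finsum_poly (p := 1)]
    · simp
    · intro n
      rw [Polynomial.coeff_one]
      change _ = MvPowerSeries.coeff (Finsupp.single 0 n) (1 : MvPowerSeries ℕ k)
      rw [MvPowerSeries.coeff_one]
      simp
  map_mul' f g := by
    obtain ⟨p, hp⟩ := exists_poly f
    obtain ⟨q, hq⟩ := exists_poly g
    rw [finsum_poly hp, finsum_poly hq, finsum_poly (p := p * q), Polynomial.eval_mul]
    intro n
    rw [Polynomial.coeff_mul, ← toFinsupp_single]
    change _ = coeffL k [n] (f * g)
    rw [coeffL_mul]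
    simp only [splitSum]
    refine Finset.sum_congr rfl fun x _ => ?_
    rw [hp, hq, ← toFinsupp_single, ← toFinsupp_single]
    rfl
  map_zero' := by
    rw [finsum_poly (p := 0)]
    · simp
    · intro n
      simp
  map_add' f g := by
    obtain ⟨p, hp⟩ := exists_poly f
    obtain ⟨q, hq⟩ := exists_poly g
    rw [finsum_poly hp, finsum_poly hq, finsum_poly (p := p + q), Polynomial.eval_add]
    intro n
    rw [Polynomial.coeff_add, hp, hq]
    rfl
  commutes' r := by
    rw [finsum_poly (p := Polynomial.C r)]
    · simp
    · intro n
      rw [Polynomial.coeff_C]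
      change _ = MvPowerSeries.coeff (Finsupp.single 0 n) (algebraMap k (MvPowerSeries ℕ k) r)
      rw [MvPowerSeries.algebraMap_apply, Algebra.algebraMap_self, RingHom.id_apply,
        MvPowerSeries.coeff_C]
      simp

end zeta


section combinatorial

variable {k : Type u} [CommRing k]

/-- The coproduct and the counit preserve the grading: `Δ(C_n) ⊆ ⊕_{i+j=n} C_i ⊗ C_j`, and
`ε` vanishes in positive degrees. -/
structure IsGradedCoalgebra {C : Type v} [AddCommGroup C] [Module k C] [Coalgebra k C]
    (𝒞 : ℕ → Submodule k C) : Prop where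
  comul_mem : ∀ n, ∀ x ∈ 𝒞 n, Coalgebra.comul (R := k) x ∈
    ⨆ p ∈ Finset.HasAntidiagonal.antidiagonal n,
      LinearMap.range (TensorProduct.mapIncl (𝒞 p.1) (𝒞 p.2))
  counit_eq_zero : ∀ n, n ≠ 0 → ∀ x ∈ 𝒞 n, Coalgebra.counit (R := k) x = 0

variable (k)

/-- A combinatorial coalgebra `(C, ζ)`: a graded connected coalgebra `C = ⊕_n C_n` over `k` whose
homogeneous components are finitely generated, with a linear functional `ζ : C → k` that is
normalized, i.e. agrees with the counit on `C_0`. -/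
structure CombinatorialCoalgebra where
  carrier : Type v
  [addCommGroup : AddCommGroup carrier]
  [module : Module k carrier]
  [coalgebra : Coalgebra k carrier]
  grading : ℕ → Submodule k carrier
  [decomposition : DirectSum.Decomposition grading]
  graded : IsGradedCoalgebra grading
  connected : Function.Bijective
    ((Coalgebra.counit : carrier →ₗ[k] k) ∘ₗ (grading 0).subtype)
  finite : ∀ n, Module.Finite k (grading n)
  zeta : carrier →ₗ[k] k
  zeta_zero : ∀ x ∈ grading 0, zeta x = Coalgebra.counit (R := k) x

/-- A combinatorial Hopf algebra `(H, ζ)`: a graded connected Hopf algebra `H = ⊕_n H_n` over `k`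
whose homogeneous components are finitely generated, with a character `ζ : H → k`. -/
structure CombinatorialHopfAlgebra where
  carrier : Type v
  [ring : Ring carrier]
  [hopfAlgebra : HopfAlgebra k carrier]
  grading : ℕ → Submodule k carrier
  [gradedAlgebra : GradedAlgebra grading]
  graded : IsGradedCoalgebra grading
  antipode_mem : ∀ n, ∀ x ∈ grading n, HopfAlgebra.antipode k x ∈ grading n
  connected : grading 0 = Submodule.span k {1}
  finite : ∀ n, Module.Finite k (grading n)
  zeta : carrier →ₐ[k] k

attribute [instance] CombinatorialCoalgebra.addCommGroup CombinatorialCoalgebra.module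
  CombinatorialCoalgebra.coalgebra CombinatorialCoalgebra.decomposition
  CombinatorialHopfAlgebra.ring CombinatorialHopfAlgebra.hopfAlgebra
  CombinatorialHopfAlgebra.gradedAlgebra

variable {k}

/-- A morphism of combinatorial coalgebras: a morphism of graded coalgebras that is compatible with
the functionals. -/
@[ext]
structure CombinatorialCoalgebra.Hom (A : CombinatorialCoalgebra.{u, v} k)
    (B : CombinatorialCoalgebra.{u, w} k) where
  toCoalgHom : A.carrier →ₗc[k] B.carrier
  map_mem : ∀ n, ∀ x ∈ A.grading n, toCoalgHom x ∈ B.grading n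
  zeta_comp : ∀ x, B.zeta (toCoalgHom x) = A.zeta x

/-- A morphism of combinatorial Hopf algebras: a morphism of graded Hopf algebras that is compatible
with the characters. (A bialgebra morphism of Hopf algebras commutes with the antipodes.) -/
@[ext]
structure CombinatorialHopfAlgebra.Hom (A : CombinatorialHopfAlgebra.{u, v} k)
    (B : CombinatorialHopfAlgebra.{u, w} k) where
  toBialgHom : A.carrier →ₐc[k] B.carrier
  map_mem : ∀ n, ∀ x ∈ A.grading n, toBialgHom x ∈ B.grading n
  zeta_comp : ∀ x, B.zeta (toBialgHom x) = A.zeta x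

/-- The category of combinatorial coalgebras over `k`. -/
instance CombinatorialCoalgebra.instCategory :
    CategoryTheory.Category (CombinatorialCoalgebra.{u, v} k) where
  Hom A B := A.Hom B
  id A := ⟨CoalgHom.id k A.carrier, fun _ _ h => h, fun _ => rfl⟩
  comp f g := ⟨g.toCoalgHom.comp f.toCoalgHom, fun n x h => g.map_mem n _ (f.map_mem n x h),
    fun x => (g.zeta_comp _).trans (f.zeta_comp x)⟩

/-- The category of combinatorial Hopf algebras over `k`. -/
instance CombinatorialHopfAlgebra.instCategory :
    CategoryTheory.Category (CombinatorialHopfAlgebra.{u, v} k) where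
  Hom A B := A.Hom B
  id A := ⟨BialgHom.id k A.carrier, fun _ _ h => h, fun _ => rfl⟩
  comp f g := ⟨g.toBialgHom.comp f.toBialgHom, fun n x h => g.map_mem n _ (f.map_mem n x h),
    fun x => (g.zeta_comp _).trans (f.zeta_comp x)⟩

section zetaComp

variable {C : Type v} [AddCommGroup C] [Module k C]

/-- The iterated coproduct with `n` tensor factors, `Δ^{(n-1)} : C → C^{⊗ n}`. For `n = 0` it is the
counit, and for `n = 1` the identity (up to the identification of `C^{⊗ 1}` with `C`). -/
noncomputable def iteratedComul (k : Type u) [CommRing k] (C : Type v) [AddCommGroup C] [Module k C]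
    [Coalgebra k C] : (n : ℕ) → C →ₗ[k] PiTensorProduct k fun _ : Fin n => C
  | 0 => (PiTensorProduct.isEmptyEquiv (Fin 0)).symm.toLinearMap ∘ₗ Coalgebra.counit
  | n + 1 => TensorPower.mulEquiv.toLinearMap ∘ₗ
      TensorProduct.map (iteratedComul k C n)
        (PiTensorProduct.subsingletonEquiv (0 : Fin 1)).symm.toLinearMap ∘ₗ Coalgebra.comul

/-- The canonical projection of `C = ⊕_n C_n` onto the homogeneous component `C_n`. -/
noncomputable def component (𝒞 : ℕ → Submodule k C) [DirectSum.Decomposition 𝒞] (n : ℕ) :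
    C →ₗ[k] 𝒞 n :=
  DirectSum.component k ℕ (fun n => 𝒞 n) n ∘ₗ (DirectSum.decomposeLinearEquiv 𝒞).toLinearMap

/-- The functional `ζ_α : C → C^{⊗ n} ↠ C_{a_1} ⊗ ⋯ ⊗ C_{a_n} → k` for `α = (a_1, …, a_n)`: the
iterated coproduct, followed by the canonical projection, followed by `ζ ⊗ ⋯ ⊗ ζ`. -/
noncomputable def zetaComp [Coalgebra k C] (𝒞 : ℕ → Submodule k C) [DirectSum.Decomposition 𝒞]
    (ζ : C →ₗ[k] k) {n : ℕ} (α : Fin n → ℕ) : C →ₗ[k] k :=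
  PiTensorProduct.lift ((MultilinearMap.mkPiAlgebra k (Fin n) k).compLinearMap
      fun i => ζ ∘ₗ (𝒞 (α i)).subtype) ∘ₗ
    PiTensorProduct.map (fun i => component 𝒞 (α i)) ∘ₗ
    iteratedComul k C n

end zetaComp

variable (k)

theorem isGradedCoalgebra_grading : IsGradedCoalgebra (grading k) where
  comul_mem n x hx := by
    induction hx using Submodule.span_induction with
    | mem y hy =>
      obtain ⟨c, rfl⟩ := hy
      rw [comul_eq, comulL_M _ (fun h => absurd (c.blocks_pos h) (lt_irrefl 0))]
      refine Submodule.sum_mem _ fun i _ => ?_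
      have h : ((c.blocks.take i).sum, (c.blocks.drop i).sum) ∈
          Finset.HasAntidiagonal.antidiagonal n := by
        rw [Finset.HasAntidiagonal.mem_antidiagonal]
        simp only [List.sum_take_add_sum_drop, c.blocks_sum]
      exact Submodule.mem_iSup_of_mem _ (Submodule.mem_iSup_of_mem h
        ⟨⟨_, M_mem_grading _⟩ ⊗ₜ ⟨_, M_mem_grading _⟩, rfl⟩)
    | zero => rw [map_zero]; exact Submodule.zero_mem _
    | add y z _ _ hy hz => rw [map_add]; exact Submodule.add_mem _ hy hz
    | smul r y _ hy => rw [map_smul]; exact Submodule.smul_mem _ _ hy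
  counit_eq_zero n hn x hx := by
    rw [counit_eq]
    exact coeffL_of_mem_grading hx _ (by simpa using hn.symm)

theorem grading_zero : grading k 0 = Submodule.span k {1} := by
  rw [grading, ← M_nil]
  congr 1
  ext f
  simp only [Set.mem_range, Set.mem_singleton_iff]
  constructor
  · rintro ⟨c, rfl⟩
    rw [c.blocks_eq_nil.2 rfl]
  · rintro rfl
    exact ⟨⟨[], by simp, rfl⟩, rfl⟩

theorem finite_grading (n : ℕ) : Module.Finite k (grading k n) :=
  Module.Finite.span_of_finite k (Set.finite_range _)

theorem antipodeVal_mem (α : List ℕ) : antipodeVal k α ∈ grading k α.sum := by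
  induction hn : α.length using Nat.strong_induction_on generalizing α with
  | _ n ih =>
    rw [antipodeVal]
    split_ifs with h
    · subst h; exact one_mem_grading
    · refine Submodule.neg_mem _ (Submodule.sum_mem _ fun i _ => ?_)
      rw [← List.sum_take_add_sum_drop α i]
      refine mul_mem_grading (ih _ ?_ _ rfl) (M_mem_grading _)
      have := i.2
      rw [List.length_take]
      omega

theorem antipode_mem_grading (n : ℕ) (x : QSym k) (hx : x ∈ grading k n) :
    HopfAlgebra.antipode k x ∈ grading k n := by
  change antipodeL k x ∈ grading k n
  induction hx using Submodule.span_induction with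
  | mem y hy =>
    obtain ⟨c, rfl⟩ := hy
    rw [antipodeL_M _ (fun h => absurd (c.blocks_pos h) (lt_irrefl 0))]
    have := antipodeVal_mem k c.blocks
    rwa [c.blocks_sum] at this
  | zero => rw [map_zero]; exact Submodule.zero_mem _
  | add y z _ _ hy hz => rw [map_add]; exact Submodule.add_mem _ hy hz
  | smul r y _ hy => rw [map_smul]; exact Submodule.smul_mem _ _ hy

/-- `(QSym, ζ_Q)` as a combinatorial Hopf algebra. -/
noncomputable def qsymHopf : CombinatorialHopfAlgebra.{u, u} k where
  carrier := QSym k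
  grading := grading k
  graded := isGradedCoalgebra_grading k
  antipode_mem := antipode_mem_grading k
  connected := grading_zero k
  finite := finite_grading k
  zeta := zetaQ k

/-- `(QSym, ζ_Q)` as a combinatorial coalgebra. -/
noncomputable def qsymCoalg : CombinatorialCoalgebra.{u, u} k where
  carrier := QSym k
  grading := grading k
  graded := isGradedCoalgebra_grading k
  connected := by
    constructor
    · rw [injective_iff_map_eq_zero]
      rintro ⟨x, hx⟩ h
      rw [grading_zero, Submodule.mem_span_singleton] at hx
      obtain ⟨r, rfl⟩ := hx
      have hr : Coalgebra.counit (R := k) (r • (1 : QSym k)) = r := by simp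
      have h0 : Coalgebra.counit (R := k) (r • (1 : QSym k)) = 0 := h
      refine Subtype.ext ?_
      change r • (1 : QSym k) = 0
      rw [← hr, h0, zero_smul]
    · intro r
      refine ⟨⟨r • 1, Submodule.smul_mem _ _ one_mem_grading⟩, ?_⟩
      change Coalgebra.counit (R := k) (r • (1 : QSym k)) = r
      simp
  finite := finite_grading k
  zeta := (zetaQ k).toLinearMap
  zeta_zero x hx := by
    rw [grading_zero, Submodule.mem_span_singleton] at hx
    obtain ⟨r, rfl⟩ := hx
    rw [AlgHom.toLinearMap_apply, map_smul, map_smul, map_one, Bialgebra.counit_one]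

end combinatorial

end QSymCat

/-! Everything takes place in the convolution algebra of linear functionals on a coalgebra, whose
unit is the counit. Write `c_l` for the functional on `QSym` reading off the coefficient of the
monomial with exponent list `l`. Deconcatenation says exactly that `c_u * c_v = c_{u ++ v}`
(`pr_comulL`), so every `c_l` is a convolution product of functionals `c_[a]`, and `c_[a]` is the
degree `a` part of `ζ_Q` (`zetaQ_of_mem`).

Uniqueness: pulling functionals back along a coalgebra morphism preserves convolution. If the
morphism is graded and compatible with the functionals, it pulls `c_[a]` back to the degree `a` part
`ζ_a` of `ζ`, hence `c_l` to the product of the `ζ_a` over the entries of `l` (`coeffL_hom`). All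
coefficients of the image are therefore forced, and the product is `ζ_α` when `l = α`
(`zetaComp_eq`).

Existence: the map given by the formula has these products as its coefficients
(`coeffL_comp_toQSymL`). This holds even for lists with zero entries, because `ζ_0` is the counit by
normalization. Since coefficients separate points of `QSym` and of its tensor square, compatibility
with the coproduct becomes multiplicativity of the products under concatenation.

Hopf case: if `ζ` is a character, the product of the `ζ_a` over `l`, evaluated at `x * y`, expands
over all ways to write `l` as a componentwise sum (`zetaList_mul`). Coefficients of a product of
power series obey the same rule (`coeffL_mul`), so the coalgebra morphism is multiplicative, while
its uniqueness is inherited. -/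

namespace QSymCat

open scoped TensorProduct
open WithConv

/-! ### Convolution products of the homogeneous parts of a functional. -/

section functionals

variable {k : Type u} [CommRing k] {C : Type v} [AddCommGroup C] [Module k C]

/-- The functional that agrees with `ζ` on `C_a` and vanishes on the other components. -/
noncomputable def degFunctional (𝒞 : ℕ → Submodule k C) [DirectSum.Decomposition 𝒞]
    (ζ : C →ₗ[k] k) (a : ℕ) : C →ₗ[k] k :=
  ζ ∘ₗ (𝒞 a).subtype ∘ₗ component 𝒞 a

/-- The convolution product of the functionals `degFunctional 𝒞 ζ a`, over the entries of a list. -/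
noncomputable def zetaList [Coalgebra k C] (𝒞 : ℕ → Submodule k C) [DirectSum.Decomposition 𝒞]
    (ζ : C →ₗ[k] k) (l : List ℕ) : WithConv (C →ₗ[k] k) :=
  (l.map fun a => toConv (degFunctional 𝒞 ζ a)).prod

section decomposition

variable {𝒞 : ℕ → Submodule k C} [DirectSum.Decomposition 𝒞] {ζ : C →ₗ[k] k}

theorem component_of_mem {n : ℕ} {x : C} (hx : x ∈ 𝒞 n) (a : ℕ) :
    (component 𝒞 a x : C) = if n = a then x else 0 := by
  change (DirectSum.decompose 𝒞 x a : C) = _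
  split_ifs with h
  · subst h; exact DirectSum.decompose_of_mem_same 𝒞 hx
  · exact DirectSum.decompose_of_mem_ne 𝒞 hx h

theorem degFunctional_of_mem {n : ℕ} {x : C} (hx : x ∈ 𝒞 n) (a : ℕ) :
    degFunctional 𝒞 ζ a x = if n = a then ζ x else 0 := by
  change ζ (component 𝒞 a x : C) = _
  rw [component_of_mem hx]
  split_ifs <;> simp

theorem homogeneous_ext {N : Type*} [AddCommMonoid N] [Module k N] {f g : C →ₗ[k] N}
    (h : ∀ n, ∀ x ∈ 𝒞 n, f x = g x) : f = g := by
  ext x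
  induction x using DirectSum.Decomposition.inductionOn 𝒞 with
  | zero => simp
  | homogeneous x => exact h _ _ x.2
  | add x y hx hy => rw [map_add, map_add, hx, hy]

end decomposition

variable [Coalgebra k C]

/-- Degrees add under convolution: the coproduct of an element of degree `n` lies in the sum of the
`C_p ⊗ C_q` with `p + q = n`, and a functional pair concentrated in degrees `i` and `j` sees only
`C_i ⊗ C_j`. -/
theorem convMul_eq_zero_of_mem {𝒞 : ℕ → Submodule k C} (hC : IsGradedCoalgebra 𝒞)
    {f g : WithConv (C →ₗ[k] k)} {i j : ℕ} (hf : ∀ n, n ≠ i → ∀ x ∈ 𝒞 n, f x = 0)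
    (hg : ∀ n, n ≠ j → ∀ x ∈ 𝒞 n, g x = 0) {n : ℕ} (hn : n ≠ i + j) {x : C} (hx : x ∈ 𝒞 n) :
    (f * g) x = 0 := by
  rw [LinearMap.convMul_apply]
  -- Phrased as membership in a kernel, the claim can be checked on each summand of the supremum
  -- separately.
  change _ ∈ LinearMap.ker (LinearMap.mul' k k ∘ₗ TensorProduct.map f.ofConv g.ofConv)
  refine SetLike.le_def.1 (iSup₂_le fun p hp => ?_) (hC.comul_mem n x hx)
  rw [LinearMap.range_le_ker_iff]
  refine TensorProduct.ext' fun y z => ?_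
  change f y * g z = 0
  rw [Finset.HasAntidiagonal.mem_antidiagonal] at hp
  by_cases h : p.1 = i
  · rw [hg p.2 (by omega) _ z.2, mul_zero]
  · rw [hf p.1 h _ y.2, zero_mul]

/-! ### The functionals `ζ_α` as convolution products. -/

variable (𝒞 : ℕ → Submodule k C) [DirectSum.Decomposition 𝒞] (ζ : C →ₗ[k] k)

theorem zetaList_nil : zetaList 𝒞 ζ [] = 1 := rfl

theorem zetaList_cons (a : ℕ) (l : List ℕ) :
    zetaList 𝒞 ζ (a :: l) = toConv (degFunctional 𝒞 ζ a) * zetaList 𝒞 ζ l := by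
  simp [zetaList]

theorem zetaList_append (l l' : List ℕ) :
    zetaList 𝒞 ζ (l ++ l') = zetaList 𝒞 ζ l * zetaList 𝒞 ζ l' := by
  simp [zetaList]

theorem zetaList_singleton (a : ℕ) : zetaList 𝒞 ζ [a] = toConv (degFunctional 𝒞 ζ a) := by
  simp [zetaList]

/-- Applying a tensor product of functionals after the iterated coproduct is iterated convolution.
This replaces tensor powers by a product in a monoid, the only form used afterwards. -/
theorem zetaComp_eq {n : ℕ} (α : Fin n → ℕ) :
    zetaComp 𝒞 ζ α = (zetaList 𝒞 ζ (List.ofFn α)).ofConv := by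
  induction n with
  | zero =>
    ext x
    simp [zetaComp, iteratedComul, zetaList_nil, LinearMap.convOne_def,
      PiTensorProduct.isEmptyEquiv]
  | succ n ih =>
    -- The last entry is split off, not the first, since `iteratedComul` adds its new tensor factor
    -- on the right.
    rw [List.ofFn_succ', List.concat_eq_append, zetaList_append, zetaList_singleton,
      LinearMap.convMul_def, ofConv_toConv, ← ih]
    -- On `C^{⊗ n} ⊗ C`, projecting and evaluating all `n + 1` factors is the product of doing so on
    -- the first `n` and on the last; this is checked on pure tensors.
    have key : (PiTensorProduct.lift ((MultilinearMap.mkPiAlgebra k (Fin (n + 1)) k).compLinearMap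
          fun i => ζ ∘ₗ (𝒞 (α i)).subtype) ∘ₗ
        PiTensorProduct.map (fun i => component 𝒞 (α i))) ∘ₗ
        TensorPower.mulEquiv.toLinearMap ∘ₗ TensorProduct.map LinearMap.id
          (PiTensorProduct.subsingletonEquiv (0 : Fin 1)).symm.toLinearMap =
        LinearMap.mul' k k ∘ₗ TensorProduct.map
          (PiTensorProduct.lift ((MultilinearMap.mkPiAlgebra k (Fin n) k).compLinearMap
            fun i => ζ ∘ₗ (𝒞 (α i.castSucc)).subtype) ∘ₗ
          PiTensorProduct.map (fun i => component 𝒞 (α i.castSucc)))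
          (degFunctional 𝒞 ζ (α (Fin.last n))) := by
      refine TensorProduct.ext ?_
      refine PiTensorProduct.ext ?_
      ext y c
      have h : TensorPower.mulEquiv (PiTensorProduct.tprod k y ⊗ₜ[k]
          (PiTensorProduct.subsingletonEquiv (0 : Fin 1)).symm c) =
          PiTensorProduct.tprod k (Fin.append y fun _ => c) := by
        have h1 : (PiTensorProduct.subsingletonEquiv (0 : Fin 1)).symm c =
            PiTensorProduct.tprod k fun _ : Fin 1 => c := by
          rw [LinearEquiv.symm_apply_eq]; simp
        rw [h1]
        exact TensorPower.tprod_mul_tprod k y _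
      change PiTensorProduct.lift _ (PiTensorProduct.map _ (TensorPower.mulEquiv
        (PiTensorProduct.tprod k y ⊗ₜ[k] (PiTensorProduct.subsingletonEquiv (0 : Fin 1)).symm c))) =
        PiTensorProduct.lift _ (PiTensorProduct.map _ (PiTensorProduct.tprod k y)) *
          degFunctional 𝒞 ζ (α (Fin.last n)) c
      have hl : Fin.append y (fun _ : Fin 1 => c) (Fin.last n) = c :=
        Fin.append_right y (fun _ : Fin 1 => c) 0
      have hc (i : Fin n) : Fin.append y (fun _ : Fin 1 => c) i.castSucc = y i :=
        Fin.append_left y (fun _ : Fin 1 => c) i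
      rw [h, PiTensorProduct.map_tprod, PiTensorProduct.map_tprod, PiTensorProduct.lift.tprod,
        PiTensorProduct.lift.tprod]
      simp [Fin.prod_univ_castSucc, degFunctional, hl, hc]
    -- The iterated coproduct on the left factor is separated from the identification of `C` with
    -- `C^{⊗ 1}`, to expose the left side of `key`.
    have h2 : zetaComp 𝒞 ζ α = ((PiTensorProduct.lift ((MultilinearMap.mkPiAlgebra k
          (Fin (n + 1)) k).compLinearMap fun i => ζ ∘ₗ (𝒞 (α i)).subtype) ∘ₗ
        PiTensorProduct.map (fun i => component 𝒞 (α i))) ∘ₗ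
        TensorPower.mulEquiv.toLinearMap ∘ₗ TensorProduct.map LinearMap.id
          (PiTensorProduct.subsingletonEquiv (0 : Fin 1)).symm.toLinearMap) ∘ₗ
        TensorProduct.map (iteratedComul k C n) LinearMap.id ∘ₗ Coalgebra.comul := by
      have h3 : TensorProduct.map LinearMap.id
          (PiTensorProduct.subsingletonEquiv (R := k) (s := fun _ : Fin 1 => C)
            (0 : Fin 1)).symm.toLinearMap ∘ₗ
          TensorProduct.map (iteratedComul k C n) LinearMap.id =
          TensorProduct.map (iteratedComul k C n)
            (PiTensorProduct.subsingletonEquiv (R := k) (s := fun _ : Fin 1 => C)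
              (0 : Fin 1)).symm.toLinearMap := by
        rw [← TensorProduct.map_comp, LinearMap.id_comp, LinearMap.comp_id]
      rw [zetaComp, iteratedComul, ← h3]
      rfl
    rw [h2, key, LinearMap.comp_assoc, ← LinearMap.comp_assoc Coalgebra.comul,
      ← TensorProduct.map_comp]
    rfl

/-! ### Normalization and homogeneity of the convolution products. -/

variable {𝒞 ζ}

/-- Normalization of `ζ` enters here: it makes the degree `0` part of `ζ` the unit for convolution.
-/
theorem degFunctional_zero (hC : IsGradedCoalgebra 𝒞)
    (hζ : ∀ x ∈ 𝒞 0, ζ x = Coalgebra.counit (R := k) x) :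
    degFunctional 𝒞 ζ 0 = Coalgebra.counit := by
  refine homogeneous_ext (𝒞 := 𝒞) fun n x hx => ?_
  rw [degFunctional_of_mem hx]
  split_ifs with h
  · subst h; exact hζ x hx
  · exact (hC.counit_eq_zero n h x hx).symm

/-- Zero entries contribute the convolution unit. This is the counterpart of quasi-symmetry of
coefficients, `coeffL_filter`. -/
theorem zetaList_filter (hC : IsGradedCoalgebra 𝒞)
    (hζ : ∀ x ∈ 𝒞 0, ζ x = Coalgebra.counit (R := k) x) (l : List ℕ) :
    zetaList 𝒞 ζ (l.filter (· ≠ 0)) = zetaList 𝒞 ζ l := by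
  induction l with
  | nil => rfl
  | cons a l ih =>
    by_cases h : a = 0
    · subst h
      have h1 : toConv (degFunctional 𝒞 ζ 0) = 1 := by
        rw [degFunctional_zero hC hζ]; rfl
      rw [zetaList_cons, h1, one_mul, ← ih]
      simp
    · rw [List.filter_cons_of_pos (by simpa using h), zetaList_cons, zetaList_cons, ih]

theorem zetaList_of_mem (hC : IsGradedCoalgebra 𝒞) {n : ℕ} {x : C} (hx : x ∈ 𝒞 n) (l : List ℕ)
    (hl : n ≠ l.sum) : zetaList 𝒞 ζ l x = 0 := by
  induction l generalizing n x with
  | nil =>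
    rw [zetaList_nil, LinearMap.convOne_apply, hC.counit_eq_zero n (by simpa using hl) x hx,
      map_zero]
  | cons a l ih =>
    rw [zetaList_cons]
    refine convMul_eq_zero_of_mem hC (i := a) (j := l.sum) ?_ (fun m hm y hy => ih hy hm)
      (by simpa using hl) hx
    intro m hm y hy
    change degFunctional 𝒞 ζ a y = 0
    rw [degFunctional_of_mem hy, if_neg hm]

end functionals

/-! ### The universal property for combinatorial coalgebras. -/

section universal

variable {k : Type u} [CommRing k]

theorem coeffL_ext {f g : QSym k} (h : ∀ l, coeffL k l f = coeffL k l g) : f = g := by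
  refine (basisM k).ext_elem fun c => ?_
  rw [← Module.Basis.coord_apply, ← Module.Basis.coord_apply, basisM_coord, h]

/-- In degree `n` the only monomial surviving the substitution is `x_0^n`. -/
theorem zetaQ_of_mem {n : ℕ} {f : QSym k} (hf : f ∈ grading k n) :
    zetaQ k f = coeffL k [n] f := by
  change ∑ᶠ m : ℕ, MvPowerSeries.coeff (Finsupp.single 0 m) (f : MvPowerSeries ℕ k) = _
  simp only [← toFinsupp_single]
  refine finsum_eq_single _ n fun m hm => ?_
  exact coeffL_of_mem_grading hf [m] (by simpa using hm)

/-- Translates compatibility with coproducts into identities between convolutions of coefficient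
functionals; no compatibility of `Φ` is assumed. -/
theorem pr_map {C : Type*} [AddCommGroup C] [Module k C] [Coalgebra k C] (Φ : C →ₗ[k] QSym k)
    (u v : List ℕ) (x : C) :
    pr k u v (TensorProduct.map Φ Φ (Coalgebra.comul x)) =
      (toConv (coeffL k u ∘ₗ Φ) * toConv (coeffL k v ∘ₗ Φ)) x := by
  rw [LinearMap.convMul_apply, pr, LinearMap.comp_apply, ← LinearMap.comp_apply
    (TensorProduct.map _ _), ← TensorProduct.map_comp]

namespace CombinatorialCoalgebra

variable (C : CombinatorialCoalgebra.{u, v} k)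

/-- The canonical map `h ↦ ∑_{α ⊨ n} ζ_α(h) M_α` (for `h` of degree `n`) to `QSym`. -/
noncomputable def toQSymL : C.carrier →ₗ[k] QSym k :=
  DirectSum.toModule k ℕ (QSym k) (fun n => ∑ α : Composition n,
      (LinearMap.toSpanSingleton k (QSym k) (M k α.blocks) ∘ₗ
        zetaComp C.grading C.zeta α.blocksFun) ∘ₗ (C.grading n).subtype) ∘ₗ
    (DirectSum.decomposeLinearEquiv C.grading).toLinearMap

theorem toQSymL_of_mem {n : ℕ} {h : C.carrier} (hh : h ∈ C.grading n) :
    C.toQSymL h = ∑ α : Composition n,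
      zetaComp C.grading C.zeta α.blocksFun h • M k α.blocks := by
  have : DirectSum.decompose C.grading h = DirectSum.lof k ℕ (fun n => C.grading n) n ⟨h, hh⟩ :=
    DirectSum.decompose_of_mem C.grading hh
  rw [toQSymL, LinearMap.comp_apply, LinearEquiv.coe_coe, DirectSum.decomposeLinearEquiv_apply,
    this, DirectSum.toModule_lof]
  simp

/-- Arbitrary lists are needed, not only compositions: splitting a list as a componentwise sum, as
multiplication does, produces zero entries. -/
theorem coeffL_comp_toQSymL (l : List ℕ) :
    coeffL k l ∘ₗ C.toQSymL = (zetaList C.grading C.zeta l).ofConv := by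
  refine homogeneous_ext (𝒞 := C.grading) fun n h hh => ?_
  have hz (α : Composition n) : zetaComp C.grading C.zeta α.blocksFun h =
      zetaList C.grading C.zeta α.blocks h := by
    rw [zetaComp_eq, Composition.ofFn_blocksFun]
  rw [LinearMap.comp_apply, C.toQSymL_of_mem hh]
  change _ = zetaList C.grading C.zeta l h
  -- The coefficient of `M_α` at `l` is nonzero only if `α` is `l` with its zeros removed, so the
  -- right side is brought to that list as well.
  rw [← zetaList_filter C.graded C.zeta_zero l]
  simp only [map_sum, map_smul, coeffL_M, hz]
  by_cases hl : n = l.sum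
  · subst hl
    rw [Finset.sum_eq_single ⟨l.filter (· ≠ 0), fun hi => by
      rw [List.mem_filter] at hi; simpa [Nat.pos_iff_ne_zero] using hi.2, filter_sum l⟩]
    · simp
    · intro α _ hα
      rw [if_neg, smul_zero]
      rintro h'
      exact hα (Composition.ext h'.symm)
    · simp
  · rw [zetaList_of_mem C.graded hh _ (by rwa [filter_sum])]
    refine Finset.sum_eq_zero fun α _ => ?_
    rw [if_neg, smul_zero]
    intro h'
    apply hl
    rw [← filter_sum, h', α.blocks_sum]

theorem coeffL_toQSymL (l : List ℕ) (h : C.carrier) :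
    coeffL k l (C.toQSymL h) = zetaList C.grading C.zeta l h :=
  LinearMap.congr_fun (C.coeffL_comp_toQSymL l) h

theorem toQSymL_mem_grading {n : ℕ} {h : C.carrier} (hh : h ∈ C.grading n) :
    C.toQSymL h ∈ QSymCat.grading k n :=
  mem_grading_of_coeffL fun l hl => by
    rw [coeffL_toQSymL, zetaList_of_mem C.graded hh l hl.symm]

theorem zetaQ_toQSymL (h : C.carrier) : zetaQ k (C.toQSymL h) = C.zeta h := by
  suffices H : (zetaQ k).toLinearMap ∘ₗ C.toQSymL = C.zeta from LinearMap.congr_fun H h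
  refine homogeneous_ext (𝒞 := C.grading) fun n h hh => ?_
  rw [LinearMap.comp_apply, AlgHom.toLinearMap_apply,
    zetaQ_of_mem (C.toQSymL_mem_grading hh), coeffL_toQSymL, zetaList_singleton]
  change degFunctional C.grading C.zeta n h = _
  rw [degFunctional_of_mem hh, if_pos rfl]

/-- The canonical morphism from a combinatorial coalgebra to `(QSym, ζ_Q)`. -/
noncomputable def toQSym : C.Hom (qsymCoalg k) where
  toCoalgHom :=
    { C.toQSymL with
      counit_comp := by
        refine LinearMap.ext fun h => ?_
        exact C.coeffL_toQSymL [] h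
      map_comp_comul := by
        refine LinearMap.ext fun h => pr_ext fun u v => ?_
        -- Tested on the coefficients at `u` and `v`, the two sides are the convolution of the
        -- functionals for `u` and `v` and the functional for `u ++ v`.
        refine (pr_map C.toQSymL u v h).trans ?_
        refine Eq.trans ?_ (pr_comulL u v (C.toQSymL h)).symm
        rw [coeffL_toQSymL, coeffL_comp_toQSymL, coeffL_comp_toQSymL, zetaList_append] }
  map_mem _ _ hx := C.toQSymL_mem_grading hx
  zeta_comp := C.zetaQ_toQSymL

theorem toQSym_apply (h : C.carrier) : C.toQSym.toCoalgHom h = C.toQSymL h := rfl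

/-! ### Uniqueness of the morphism. -/

variable {C}

/-- Induction on `l`: the counit handles the empty list, grading and compatibility with `ζ`
determine one-entry lists, and the coproduct reduces `a :: l` to `[a]` and `l`. -/
theorem coeffL_hom (Φ : C.Hom (qsymCoalg k)) (l : List ℕ) :
    coeffL k l ∘ₗ Φ.toCoalgHom.toLinearMap = (zetaList C.grading C.zeta l).ofConv := by
  induction l with
  | nil => exact Φ.toCoalgHom.counit_comp
  | cons a l ih =>
    have ha : coeffL k [a] ∘ₗ Φ.toCoalgHom.toLinearMap = degFunctional C.grading C.zeta a := by
      refine homogeneous_ext (𝒞 := C.grading) fun n h hh => ?_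
      have hmem : Φ.toCoalgHom h ∈ QSymCat.grading k n := Φ.map_mem n h hh
      rw [degFunctional_of_mem hh]
      split_ifs with hn
      · subst hn
        exact (zetaQ_of_mem hmem).symm.trans (Φ.zeta_comp h)
      · exact coeffL_of_mem_grading hmem [a] (by simpa using Ne.symm hn)
    refine LinearMap.ext fun h => ?_
    rw [zetaList_cons, ← ha]
    have h1 := pr_comulL [a] l (Φ.toCoalgHom h)
    have h2 : comulL k (Φ.toCoalgHom h) = TensorProduct.map Φ.toCoalgHom.toLinearMap
        Φ.toCoalgHom.toLinearMap (Coalgebra.comul h) :=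
      (LinearMap.congr_fun Φ.toCoalgHom.map_comp_comul h).symm
    rw [h2] at h1
    refine h1.symm.trans ((pr_map Φ.toCoalgHom.toLinearMap [a] l h).trans ?_)
    rw [ih]

theorem hom_toQSym_unique (Φ : C.Hom (qsymCoalg k)) : Φ = C.toQSym := by
  refine CombinatorialCoalgebra.Hom.ext (CoalgHom.ext fun h => coeffL_ext fun l => ?_)
  rw [toQSym_apply, coeffL_toQSymL]
  exact LinearMap.congr_fun (coeffL_hom Φ l) h

end CombinatorialCoalgebra

end universal

/-! ### Multiplicativity and the universal property for combinatorial Hopf algebras. -/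

section hopf

variable {k : Type u} [CommRing k]

section multiplicative

variable {H : Type v} [Ring H] [Bialgebra k H] {ℋ : ℕ → Submodule k H} [GradedAlgebra ℋ]

theorem degFunctional_mul (ζ : H →ₐ[k] k) (a : ℕ) (x y : H) :
    degFunctional ℋ ζ.toLinearMap a (x * y) = ∑ p ∈ Finset.HasAntidiagonal.antidiagonal a,
      degFunctional ℋ ζ.toLinearMap p.1 x * degFunctional ℋ ζ.toLinearMap p.2 y := by
  induction x using DirectSum.Decomposition.inductionOn ℋ with
  | zero => simp
  | add x x' hx hx' => simp only [add_mul, map_add, hx, hx', Finset.sum_add_distrib]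
  | @homogeneous i x =>
    induction y using DirectSum.Decomposition.inductionOn ℋ with
    | zero => simp
    | add y y' hy hy' => simp only [mul_add, map_add, hy, hy', Finset.sum_add_distrib]
    | @homogeneous j y =>
      simp only [degFunctional_of_mem (SetLike.mul_mem_graded x.2 y.2),
        degFunctional_of_mem x.2, degFunctional_of_mem y.2]
      by_cases h : i + j = a
      · rw [if_pos h, Finset.sum_eq_single (i, j)]
        · simp
        · rintro ⟨p, q⟩ hp hne
          by_cases h1 : i = p
          · rw [if_neg (c := j = q), mul_zero]
            rintro rfl
            exact hne (by rw [h1])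
          · rw [if_neg h1, zero_mul]
        · intro h'
          exact absurd (Finset.HasAntidiagonal.mem_antidiagonal.2 h) h'
      · rw [if_neg h, Finset.sum_eq_zero]
        rintro ⟨p, q⟩ hp
        rw [Finset.HasAntidiagonal.mem_antidiagonal] at hp
        by_cases h1 : i = p
        · rw [if_neg (c := j = q), mul_zero]
          rintro rfl
          exact h (by rw [h1]; exact hp)
        · rw [if_neg h1, zero_mul]

/-- The coproduct is multiplicative, so peeling off one convolution factor reduces to
`degFunctional_mul` in the first tensor slot and to the shorter list in the second. The rule
obtained has the shape of `coeffL_mul`. -/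
theorem zetaList_mul (ζ : H →ₐ[k] k) (l : List ℕ) (x y : H) :
    zetaList ℋ ζ.toLinearMap l (x * y) = splitSum (fun u v =>
      zetaList ℋ ζ.toLinearMap u x * zetaList ℋ ζ.toLinearMap v y) l := by
  induction l generalizing x y with
  | nil => simp [zetaList_nil, splitSum]
  | cons a l ih =>
    -- Stated for arbitrary tensors in place of the coproducts of `x` and `y`, so that bilinearity
    -- reduces it to pure tensors.
    have key (X Y : H ⊗[k] H) :
        LinearMap.mul' k k (TensorProduct.map (degFunctional ℋ ζ.toLinearMap a)
          (zetaList ℋ ζ.toLinearMap l).ofConv (X * Y)) =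
        ∑ p ∈ Finset.HasAntidiagonal.antidiagonal a, splitSum (fun u v =>
          LinearMap.mul' k k (TensorProduct.map (degFunctional ℋ ζ.toLinearMap p.1)
            (zetaList ℋ ζ.toLinearMap u).ofConv X) *
          LinearMap.mul' k k (TensorProduct.map (degFunctional ℋ ζ.toLinearMap p.2)
            (zetaList ℋ ζ.toLinearMap v).ofConv Y)) l := by
      induction X with
      | zero => simp [splitSum_zero]
      | add X X' hX hX' =>
        simp only [add_mul, map_add, hX, hX', splitSum_add, Finset.sum_add_distrib]
      | tmul x x' =>
        induction Y with
        | zero => simp [splitSum_zero]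
        | add Y Y' hY hY' =>
          simp only [mul_add, map_add, hY, hY', splitSum_add, Finset.sum_add_distrib]
        | tmul y y' =>
          have h : (zetaList ℋ ζ.toLinearMap l).ofConv (x' * y') = _ := ih x' y'
          simp only [Algebra.TensorProduct.tmul_mul_tmul, TensorProduct.map_tmul,
            LinearMap.mul'_apply, h, degFunctional_mul, Finset.sum_mul]
          refine Finset.sum_congr rfl fun p _ => ?_
          rw [← splitSum_mul_left]
          congr 1
          funext u v
          change _ = (_ * zetaList ℋ ζ.toLinearMap u x') * (_ * zetaList ℋ ζ.toLinearMap v y')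
          ring
    simp only [zetaList_cons, splitSum, LinearMap.convMul_apply, Bialgebra.comul_mul]
    exact key _ _

end multiplicative

namespace CombinatorialHopfAlgebra

/-- The combinatorial coalgebra underlying a combinatorial Hopf algebra. -/
def toCoalgebra (H : CombinatorialHopfAlgebra.{u, v} k) : CombinatorialCoalgebra.{u, v} k where
  carrier := H.carrier
  grading := H.grading
  graded := H.graded
  connected := by
    constructor
    · rw [injective_iff_map_eq_zero]
      rintro ⟨x, hx⟩ h
      rw [H.connected, Submodule.mem_span_singleton] at hx
      obtain ⟨r, rfl⟩ := hx
      have hr : r = 0 := by simpa using h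
      exact Subtype.ext (by simp [hr])
    · intro r
      refine ⟨⟨r • 1, Submodule.smul_mem _ _ ?_⟩, ?_⟩
      · rw [H.connected]
        exact Submodule.mem_span_singleton_self 1
      · simp
  finite := H.finite
  zeta := H.zeta.toLinearMap
  -- Normalization is automatic for a character: degree `0` is spanned by `1`, and `ζ` and the
  -- counit both send `1` to `1`.
  zeta_zero x hx := by
    rw [H.connected, Submodule.mem_span_singleton] at hx
    obtain ⟨r, rfl⟩ := hx
    simp

variable (H : CombinatorialHopfAlgebra.{u, v} k)

theorem toQSymL_one : H.toCoalgebra.toQSymL (1 : H.carrier) = 1 := by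
  have h1 : (1 : H.carrier) ∈ H.grading 0 := SetLike.one_mem_graded H.grading
  refine coeffL_ext fun l => ?_
  refine (H.toCoalgebra.coeffL_toQSymL l _).trans ?_
  by_cases hl : 0 = l.sum
  · have h0 : l.filter (· ≠ 0) = [] := by
      rw [List.filter_eq_nil_iff]
      intro a ha
      simpa using List.sum_eq_zero_iff_forall_eq_nat.1 hl.symm a ha
    rw [← zetaList_filter H.toCoalgebra.graded H.toCoalgebra.zeta_zero, ← M_nil, coeffL_M, h0,
      if_pos rfl, zetaList_nil]
    exact Bialgebra.counit_one (R := k) (A := H.carrier)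
  · rw [zetaList_of_mem H.toCoalgebra.graded h1 l hl,
      coeffL_of_mem_grading one_mem_grading l (Ne.symm hl)]

theorem toQSymL_mul (x y : H.carrier) : H.toCoalgebra.toQSymL (x * y : H.carrier) =
    H.toCoalgebra.toQSymL x * H.toCoalgebra.toQSymL y := by
  refine coeffL_ext fun l => ?_
  refine (H.toCoalgebra.coeffL_toQSymL l _).trans ?_
  rw [coeffL_mul]
  refine (zetaList_mul (ℋ := H.grading) H.zeta l x y).trans ?_
  congr 1
  funext u v
  exact congrArg₂ _ (H.toCoalgebra.coeffL_toQSymL u x).symm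
    (H.toCoalgebra.coeffL_toQSymL v y).symm

/-- The canonical morphism from a combinatorial Hopf algebra to `(QSym, ζ_Q)`. -/
noncomputable def toQSym : H.Hom (qsymHopf k) where
  toBialgHom :=
    { H.toCoalgebra.toQSym.toCoalgHom with
      map_one' := H.toQSymL_one
      map_mul' := H.toQSymL_mul }
  map_mem := H.toCoalgebra.toQSym.map_mem
  zeta_comp := H.toCoalgebra.toQSym.zeta_comp

variable {H}

theorem hom_toQSym_unique (Φ : H.Hom (qsymHopf k)) : Φ = H.toQSym := by
  -- Forgetting the multiplication suffices: both versions of `QSym` carry the same graded coalgebra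
  -- and the same functional, so coalgebra uniqueness applies.
  let Φ' : H.toCoalgebra.Hom (qsymCoalg k) :=
    ⟨Φ.toBialgHom.toCoalgHom, Φ.map_mem, Φ.zeta_comp⟩
  have h := CombinatorialCoalgebra.hom_toQSym_unique Φ'
  refine CombinatorialHopfAlgebra.Hom.ext (BialgHom.ext fun x => ?_)
  exact DFunLike.congr_fun (congrArg CombinatorialCoalgebra.Hom.toCoalgHom h) x

end CombinatorialHopfAlgebra

end hopf

end QSymCat

/-- The first two clauses allow carriers in any universe. Terminality is asserted in the categories
containing `QSym k` itself, whose carriers lie in the universe of `k`. -/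
theorem theoremT (k : Type u) [CommRing k] :
    -- combinatorial coalgebras
    (∀ C : QSymCat.CombinatorialCoalgebra.{u, v} k,
      ∃ Ψ : C.Hom (QSymCat.qsymCoalg k), (∀ Φ : C.Hom (QSymCat.qsymCoalg k), Φ = Ψ) ∧
        ∀ n, ∀ h ∈ C.grading n, Ψ.toCoalgHom h =
          ∑ α : Composition n, QSymCat.zetaComp C.grading C.zeta α.blocksFun h •
            QSymCat.M k α.blocks) ∧
    -- combinatorial Hopf algebras
    (∀ H : QSymCat.CombinatorialHopfAlgebra.{u, v} k,
      ∃ Ψ : H.Hom (QSymCat.qsymHopf k), (∀ Φ : H.Hom (QSymCat.qsymHopf k), Φ = Ψ) ∧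
        ∀ n, ∀ h ∈ H.grading n, Ψ.toBialgHom h =
          ∑ α : Composition n, QSymCat.zetaComp H.grading H.zeta.toLinearMap α.blocksFun h •
            QSymCat.M k α.blocks) ∧
    -- terminal objects
    Nonempty (CategoryTheory.Limits.IsTerminal (QSymCat.qsymCoalg k)) ∧
    Nonempty (CategoryTheory.Limits.IsTerminal (QSymCat.qsymHopf k)) := by
  refine ⟨fun C => ⟨C.toQSym, QSymCat.CombinatorialCoalgebra.hom_toQSym_unique,
      fun n h hh => C.toQSymL_of_mem hh⟩,
    fun H => ⟨H.toQSym, QSymCat.CombinatorialHopfAlgebra.hom_toQSym_unique,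
      fun n h hh => H.toCoalgebra.toQSymL_of_mem hh⟩,
    ⟨CategoryTheory.Limits.IsTerminal.ofUniqueHom (fun C => C.toQSym)
      fun _ => QSymCat.CombinatorialCoalgebra.hom_toQSym_unique⟩,
    ⟨CategoryTheory.Limits.IsTerminal.ofUniqueHom (fun H => H.toQSym)
      fun _ => QSymCat.CombinatorialHopfAlgebra.hom_toQSym_unique⟩⟩
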